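/- Let $p\in(0,1)$, $K>0$, $\gamma\in(0,1/2)$ and $d_0\in(0,1)$. **Regression function.** $f:[0,1]\to\mathbb R$ is increasing and differentiable on $[0,1]$ with $0<\inf_{[0,1]}f'\le\sup_{[0,1]}f'<\infty$; in a neighbourhood of $d_0$, $f'$ is positive and continuous and $f'''$ exists and is bounded. Put $\theta_0=f(d_0)$. (Where $f$ has to be evaluated outside $[0,1]$ it is extended arbitrarily.) **Design.** $\{x_{i,m}\}_{1\le i\le m}$, $m\ge 1$, is a triangular array with $0\le x_{1,m}<\dots<x_{m,m}\le 1$. There are a distribution function $G$, with a Lebesgue density that is positive and has a bounded first derivative on $[0,1]$, and a constant $C$ such that $\sup_{x\in[0,1]}|F_m(x)-G(x)|\le C m^{-1/2}$ for all $m\ge1$, where $F_m$ is the empirical distribution function of $x_{1,m},\dots,x_{m,m}$. **Errors.** For each $n$ let $n_1=\lfloor np\rfloor$ if $n-\lfloor np\rfloor$ is even, $n_1=\lfloor np\rfloor+1$ otherwise, and $n_2=(n-n_1)/2$. On a probability space $(\Omega,\mathscr A,P)$ there are random variables $\varepsilon_{i,n}$ ($i\le n_1$), $\varepsilon'_{i,n}$,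 $\varepsilon''_{i,n}$ ($i\le n_2$), all with the same law for all $i$ and $n$, with mean zero and all absolute moments finite, and for each $n$ the $n_1+2n_2$ variables with second index $n$ are mutually independent. **Two-stage procedure.** Let $\hat f_n$ be an isotonic regression estimate from the data $(x_{i,n_1},\,f(x_{i,n_1})+\varepsilon_{i,n})$, $i\le n_1$, that is, an increasing function on $[0,1]$ which minimises the residual sum of squares among all increasing functions on $[0,1]$. Let $\hat d=\inf\{x\in[0,1]:\hat f_n(x)\ge\theta_0\}$, $L=\hat d-Kn_1^{-\gamma}$, $U=\hat d+Kn_1^{-\gamma}$, $Y_i'=f(L)+\varepsilon'_{i,n}$ and $Y_i''=f(U)+\varepsilon''_{i,n}$ for $i\le n_2$. Let $(\hat\beta_0,\hat\beta_1)$ be a least squares fit of $y=\beta_0+\beta_1x$ to the $2n_2$ points $(L,Y_i'),(U,Y_i'')$. **Bootstrap.** Given the data, draw $Y_1'^\star,\dots,Y_{n_2}'^\star$ and $Y_1''^\star,\dots,Y_{n_2}''^\star$ independently, with replacement, from $\{Y_i'\}_{i\le n_2}$ and from $\{Y_i''\}_{i\le n_2}$ respectively. Let $(\hat\beta_0^\star,\hat\beta_1^\star)$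 be a least squares fit of $y=\beta_0+\beta_1x$ to the points $(L,Y_i'^\star),(U,Y_i''^\star)$, $i\le n_2$, and let $P^\star$ denote the probability of the resampling conditional on the data (that is, for fixed $\omega$). Then, as $n\to\infty$, $\hat\beta_1\to f'(d_0)$ $P$-almost surely; and for $P$-almost every $\omega$, $\hat\beta_1^\star\to f'(d_0)$ in $P^\star$-probability, that is, $P^\star(|\hat\beta_1^\star-f'(d_0)|\ge\delta)\to0$ for every $\delta>0$. -/

import Mathlib

open MeasureTheory ProbabilityTheory Filter Topology Set

noncomputable section

namespace TwoStage

/-- The regression functions that are increasing on `[0,1]` and have a positive and continuous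
first derivative in a neighbourhood of `d₀`. -/
def ClassF0 (d₀ : ℝ) : Set (ℝ → ℝ) :=
  {f | MonotoneOn f (Icc 0 1) ∧
    ∀ᶠ x in 𝓝 d₀, DifferentiableAt ℝ f x ∧ 0 < deriv f x ∧ ContinuousAt (deriv f) x}

/-- The members of `ClassF0 d₀` whose third derivative exists and is uniformly bounded in a
neighbourhood of `d₀`. -/
def ClassF (d₀ : ℝ) : Set (ℝ → ℝ) :=
  {f | f ∈ ClassF0 d₀ ∧ ∃ M : ℝ, ∀ᶠ x in 𝓝 d₀,
    (∀ k < 3, DifferentiableAt ℝ (iteratedDeriv k f) x) ∧ |iteratedDeriv 3 f x| ≤ M}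

/-- The empirical distribution function of the points `x 0, …, x (m - 1)`. -/
def empiricalCDF {m : ℕ} (x : Fin m → ℝ) (t : ℝ) : ℝ :=
  (Finset.univ.filter fun i => x i ≤ t).card / (m : ℝ)

/-- A triangular array of design points; row `m` consists of `m` increasing points of `[0,1]`. -/
def IsDesignArray (x : (m : ℕ) → Fin m → ℝ) : Prop :=
  ∀ m, StrictMono (x m) ∧ ∀ i, x m i ∈ Icc (0 : ℝ) 1

/-- Assumption (A2): the empirical distribution functions of the design approach, at the rate
`m ^ (-1/2)` uniformly on `[0,1]`, the distribution function of a law `ν` whose Lebesgue density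
`g` is positive on `[0,1]` and has a bounded first derivative there. -/
def AssumptionA2 (x : (m : ℕ) → Fin m → ℝ) : Prop :=
  ∃ (ν : Measure ℝ) (g : ℝ → ℝ),
    IsProbabilityMeasure ν ∧ Measurable g ∧ (∀ t, 0 ≤ g t) ∧
    ν = volume.withDensity (fun t => ENNReal.ofReal (g t)) ∧
    (∀ t ∈ Icc (0 : ℝ) 1, 0 < g t) ∧
    DifferentiableOn ℝ g (Icc 0 1) ∧
    (∃ B : ℝ, ∀ t ∈ Icc (0 : ℝ) 1, |derivWithin g (Icc 0 1) t| ≤ B) ∧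
    ∃ C : ℝ, ∀ m : ℕ, 0 < m → ∀ t ∈ Icc (0 : ℝ) 1,
      |empiricalCDF (x m) t - cdf ν t| ≤ C * (m : ℝ) ^ (-(1 / 2) : ℝ)

/-- Assumption (A3) (apart from membership in `ClassF0`): `f` is differentiable on `[0,1]`
(one-sidedly at the end points), and the infimum and the supremum of `f'` over `[0,1]` are positive
and finite. -/
def AssumptionA3 (f : ℝ → ℝ) : Prop :=
  DifferentiableOn ℝ f (Icc 0 1) ∧
    ∃ c C : ℝ, 0 < c ∧ ∀ x ∈ Icc (0 : ℝ) 1,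
      c ≤ derivWithin f (Icc 0 1) x ∧ derivWithin f (Icc 0 1) x ≤ C

/-- Assumption (A4) on the law `Q` of the errors: all absolute moments are finite. -/
def AssumptionA4 (Q : Measure ℝ) : Prop :=
  ∀ q : ℕ, Integrable (fun e : ℝ => |e| ^ q) Q

/-- The first-stage sample size `n₁`: `⌊np⌋` or `⌊np⌋ + 1`, according to whether `n - ⌊np⌋` is even
or not. -/
def firstSize (p : ℝ) (n : ℕ) : ℕ :=
  if Even (n - ⌊(n : ℝ) * p⌋₊) then ⌊(n : ℝ) * p⌋₊ else ⌊(n : ℝ) * p⌋₊ + 1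

/-- The number `n₂` of second-stage observations at each of the two sampling points, so that
`n = n₁ + 2 n₂`. -/
def secondSize (p : ℝ) (n : ℕ) : ℕ := (n - firstSize p n) / 2

/-- `fhat` is an isotonic regression estimate on `[0,1]` from the data `(x i, Y i)`: it is
increasing on `[0,1]` and minimises the sum of squares among all such functions. -/
def IsIsotonicRegression {m : ℕ} (x Y : Fin m → ℝ) (fhat : ℝ → ℝ) : Prop :=
  MonotoneOn fhat (Icc 0 1) ∧
    ∀ h : ℝ → ℝ, MonotoneOn h (Icc 0 1) →
      ∑ i, (Y i - fhat (x i)) ^ 2 ≤ ∑ i, (Y i - h (x i)) ^ 2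

/-- The generalised inverse `inf {t ∈ [0,1] : fhat t ≥ θ}`. -/
def genInverse (fhat : ℝ → ℝ) (θ : ℝ) : ℝ := sInf {t | t ∈ Icc (0 : ℝ) 1 ∧ θ ≤ fhat t}

/-- The lower second-stage sampling point `d - K n₁ ^ (-γ)`. -/
def lowerPoint (K γ : ℝ) (n₁ : ℕ) (d : ℝ) : ℝ := d - K * (n₁ : ℝ) ^ (-γ)

/-- The upper second-stage sampling point `d + K n₁ ^ (-γ)`. -/
def upperPoint (K γ : ℝ) (n₁ : ℕ) (d : ℝ) : ℝ := d + K * (n₁ : ℝ) ^ (-γ)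

/-- `(b₀, b₁)` (intercept, slope) is a least squares fit of the linear model `y = b₀ + b₁ x` to the
data `(L, Y' i)`, `(U, Y'' i)`, `i < k`. -/
def IsLeastSquaresFit {k : ℕ} (L U : ℝ) (Y' Y'' : Fin k → ℝ) (b : ℝ × ℝ) : Prop :=
  ∀ c : ℝ × ℝ,
    ∑ i, ((Y' i - b.1 - b.2 * L) ^ 2 + (Y'' i - b.1 - b.2 * U) ^ 2) ≤
      ∑ i, ((Y' i - c.1 - c.2 * L) ^ 2 + (Y'' i - c.1 - c.2 * U) ^ 2)

/-- The bootstrap probability given the data: the law of the pair of index vectors of two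
independent samples of size `k`, each drawn with replacement from `k` items. -/
def bootstrapMeasure (k : ℕ) : Measure ((Fin k → Fin k) × (Fin k → Fin k)) :=
  (Measure.pi fun _ : Fin k => uniformOn (univ : Set (Fin k))).prod
    (Measure.pi fun _ : Fin k => uniformOn (univ : Set (Fin k)))

end TwoStage

end

/-!
Moment bounds for sums of independent centred variables, Markov's inequality and Borel–Cantelli
show that almost surely the first-stage partial error sums are `o(n)` uniformly over blocks, while
the second-stage error sums and sums of squared errors are `o(n ^ (1 - γ))` and
`o(n ^ (2 - 2 * γ))`. On that event everything is deterministic. Minimality of the isotonic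
estimate bounds its level at a point by averages of the data over blocks next to that point, so
`dhat → d₀`. The fitted slope is the difference quotient of the second-stage means at `L` and `U`;
its noise part is `o(1)` because `U - L` is of order `n ^ (-γ)`, and its main part tends to
`f' d₀` by strict differentiability. Chebyshev's inequality for the resampling, whose variance is
controlled by the sums of squared errors, transfers the limit to the bootstrapped slope.
-/

open Asymptotics
open scoped BigOperators

namespace TwoStage

section Noise

variable {Ω ι : Type*} [MeasurableSpace Ω] {P : Measure Ω} {X : ι → Ω → ℝ} {r : ℕ} {M : ℝ}

/-- Independent centred errors whose absolute moments of order `r` are bounded by `M`. The errors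
need not have a common law. -/
structure IsNoise (X : ι → Ω → ℝ) (r : ℕ) (M : ℝ) (P : Measure Ω) : Prop where
  indep : iIndepFun X P
  memLp : ∀ i, MemLp (X i) r P
  integral_eq_zero : ∀ i, ∫ ω, X i ω ∂P = 0
  integral_abs_pow_le : ∀ i, ∫ ω, |X i ω| ^ r ∂P ≤ M

theorem IsNoise.bound_nonneg (hX : IsNoise X r M P) (i : ι) : 0 ≤ M :=
  (integral_nonneg fun _ => by positivity).trans (hX.integral_abs_pow_le i)

variable [IsProbabilityMeasure P]

theorem integrable_pow_of_memLp {S : Ω → ℝ} {j k : ℕ} (hS : MemLp S k P) (hjk : j ≤ k) :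
    Integrable (fun ω => S ω ^ j) P :=
  (hS.mono_exponent (mod_cast hjk : (j : ENNReal) ≤ k)).integrable_norm_pow'.mono' (hS.1.pow j)
    (ae_of_all _ fun ω => (norm_pow (S ω) j).le)

theorem integral_add_pow_of_indepFun {S X : Ω → ℝ} {k : ℕ} (hSX : IndepFun S X P)
    (hS : MemLp S k P) (hX : MemLp X k P) :
    ∫ ω, (S ω + X ω) ^ k ∂P =
      ∑ j ∈ Finset.range (k + 1), (∫ ω, S ω ^ j ∂P) * (∫ ω, X ω ^ (k - j) ∂P) * k.choose j := by
  have hind (i j : ℕ) : IndepFun (fun ω => S ω ^ i) (fun ω => X ω ^ j) P :=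
    hSX.comp (φ := fun x => x ^ i) (ψ := fun x => x ^ j) (by fun_prop) (by fun_prop)
  simp_rw [add_pow]
  rw [integral_finsetSum]
  · refine Finset.sum_congr rfl fun j _ => ?_
    rw [integral_mul_const,
      (hind j (k - j)).integral_fun_mul_eq_mul_integral (hS.1.pow j) (hX.1.pow _)]
  · intro j hj
    exact ((hind j (k - j)).integrable_mul
      (integrable_pow_of_memLp hS (Finset.mem_range_succ_iff.1 hj))
      (integrable_pow_of_memLp hX (Nat.sub_le k j))).mul_const _

theorem IsNoise.abs_integral_pow_le (hX : IsNoise X r M P) {j : ℕ} (hj : j ≤ r) (i : ι) :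
    |∫ ω, X i ω ^ j ∂P| ≤ 1 + M := by
  have habs : Integrable (fun ω => |X i ω| ^ r) P := (hX.memLp i).integrable_norm_pow'
  have hpow (x : ℝ) : |x ^ j| ≤ 1 + |x| ^ r := by
    rw [abs_pow]
    rcases le_total |x| 1 with hx | hx
    · exact (pow_le_one₀ (abs_nonneg x) hx).trans (le_add_of_nonneg_right (by positivity))
    · exact (pow_le_pow_right₀ hx hj).trans (le_add_of_nonneg_left zero_le_one)
  calc |∫ ω, X i ω ^ j ∂P| ≤ ∫ ω, |X i ω ^ j| ∂P := abs_integral_le_integral_abs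
    _ ≤ ∫ ω, (1 + |X i ω| ^ r) ∂P :=
      integral_mono (integrable_pow_of_memLp (hX.memLp i) hj).abs
        ((integrable_const 1).add habs) fun ω => hpow (X i ω)
    _ ≤ 1 + M := by
      rw [integral_add (integrable_const 1) habs]
      simpa using hX.integral_abs_pow_le i

theorem IsNoise.memLp_sum (hX : IsNoise X r M P) {k : ℕ} (hk : k ≤ r) (s : Finset ι) :
    MemLp (fun ω => ∑ i ∈ s, X i ω) k P :=
  memLp_finsetSum s fun i _ =>
    (hX.memLp i).mono_exponent (mod_cast hk : (k : ENNReal) ≤ r)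

/-- The term of the binomial expansion which is linear in the added variable vanishes: this is what
makes the moments of order `l + 2` grow one factor `#s` slower than the trivial bound. -/
theorem IsNoise.integral_sum_insert_pow [DecidableEq ι] (hX : IsNoise X r M P) {l : ℕ}
    (hl : l + 2 ≤ r) {t : Finset ι} {a : ι} (ha : a ∉ t) :
    ∫ ω, (∑ i ∈ insert a t, X i ω) ^ (l + 2) ∂P =
      (∑ j ∈ Finset.range (l + 1), (∫ ω, (∑ i ∈ t, X i ω) ^ j ∂P) *
        (∫ ω, X a ω ^ (l + 2 - j) ∂P) * (l + 2).choose j) +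
      ∫ ω, (∑ i ∈ t, X i ω) ^ (l + 2) ∂P := by
  have hindep : IndepFun (fun ω => ∑ i ∈ t, X i ω) (X a) P := by
    convert hX.indep.indepFun_finsetSum_of_notMem₀ (fun i => (hX.memLp i).1.aemeasurable) ha
      using 1
    ext ω
    rw [Finset.sum_apply]
  simp_rw [Finset.sum_insert ha, add_comm (X a _)]
  rw [integral_add_pow_of_indepFun hindep (hX.memLp_sum hl t)
      ((hX.memLp a).mono_exponent (mod_cast hl : ((l + 2 : ℕ) : ENNReal) ≤ r)),
    Finset.sum_range_succ, Finset.sum_range_succ]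
  simp [hX.integral_eq_zero a]

theorem sum_range_mul_choose_le {B : ℝ} (hB : 1 ≤ B) (l : ℕ) :
    ∑ j ∈ Finset.range (l + 1), (j * B) ^ j * B * (l + 2).choose j ≤
      (((l + 2 : ℕ) : ℝ) * B) ^ (l + 2) := by
  calc ∑ j ∈ Finset.range (l + 1), (j * B) ^ j * B * (l + 2).choose j
      ≤ ∑ j ∈ Finset.range (l + 1), (l + 1 : ℝ) ^ j * (l + 2).choose j * B ^ (l + 2) := by
        refine Finset.sum_le_sum fun j hj => ?_
        have hjl : j ≤ l := Finset.mem_range_succ_iff.1 hj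
        have hjl' : (j : ℝ) ≤ l + 1 := by exact_mod_cast hjl.trans l.le_succ
        calc (j * B) ^ j * B * (l + 2).choose j
            = (j : ℝ) ^ j * (l + 2).choose j * B ^ (j + 1) := by ring
          _ ≤ (l + 1 : ℝ) ^ j * (l + 2).choose j * B ^ (l + 2) := by gcongr; omega
    _ ≤ ∑ j ∈ Finset.range (l + 2 + 1), (l + 1 : ℝ) ^ j * (l + 2).choose j * B ^ (l + 2) :=
        Finset.sum_le_sum_of_subset_of_nonneg (Finset.range_mono (by omega))
          fun j _ _ => by positivity
    _ = (((l + 2 : ℕ) : ℝ) * B) ^ (l + 2) := by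
        have hbinom := add_pow (l + 1 : ℝ) 1 (l + 2)
        simp only [one_pow, mul_one] at hbinom
        rw [← Finset.sum_mul, ← hbinom, mul_pow]
        push_cast
        ring

theorem IsNoise.abs_integral_sum_insert_pow_le [DecidableEq ι] (hX : IsNoise X r M P) {l N : ℕ}
    (hl : l + 2 ≤ r) {t : Finset ι} {a : ι} (ha : a ∉ t) (htN : t.card < N)
    (hmom : ∀ j ≤ l, |∫ ω, (∑ i ∈ t, X i ω) ^ j ∂P| ≤ (j * (1 + M)) ^ j * √(t.card : ℝ) ^ j) :
    |∫ ω, (∑ i ∈ insert a t, X i ω) ^ (l + 2) ∂P| ≤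
      ((l + 2 : ℕ) * (1 + M)) ^ (l + 2) * √(N : ℝ) ^ l +
        |∫ ω, (∑ i ∈ t, X i ω) ^ (l + 2) ∂P| := by
  have hM := hX.bound_nonneg a
  have hN : 1 ≤ √(N : ℝ) := Real.one_le_sqrt.2 (by exact_mod_cast (by omega))
  have hterm : ∀ j ∈ Finset.range (l + 1), |(∫ ω, (∑ i ∈ t, X i ω) ^ j ∂P) *
      (∫ ω, X a ω ^ (l + 2 - j) ∂P) * (l + 2).choose j| ≤
      (j * (1 + M)) ^ j * (1 + M) * (l + 2).choose j * √(N : ℝ) ^ l := by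
    intro j hj
    have hjl : j ≤ l := Finset.mem_range_succ_iff.1 hj
    have hpow : √(t.card : ℝ) ^ j ≤ √(N : ℝ) ^ l :=
      (pow_le_pow_left₀ (by positivity) (Real.sqrt_le_sqrt (mod_cast htN.le)) j).trans
        (pow_le_pow_right₀ hN hjl)
    rw [abs_mul, abs_mul, Nat.abs_cast]
    calc |∫ ω, (∑ i ∈ t, X i ω) ^ j ∂P| * |∫ ω, X a ω ^ (l + 2 - j) ∂P| * (l + 2).choose j
        ≤ ((j * (1 + M)) ^ j * √(t.card : ℝ) ^ j) * (1 + M) * (l + 2).choose j := by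
          gcongr
          · exact hmom j hjl
          · exact hX.abs_integral_pow_le (by omega) a
      _ ≤ ((j * (1 + M)) ^ j * √(N : ℝ) ^ l) * (1 + M) * (l + 2).choose j := by gcongr
      _ = _ := by ring
  rw [hX.integral_sum_insert_pow hl ha]
  refine (abs_add_le _ _).trans (add_le_add_left ?_ _)
  refine (Finset.abs_sum_le_sum_abs _ _).trans ((Finset.sum_le_sum hterm).trans ?_)
  rw [← Finset.sum_mul]
  gcongr
  exact sum_range_mul_choose_le (by linarith) l

theorem IsNoise.abs_integral_sum_pow_le (hX : IsNoise X r M P) {k : ℕ} (hk : k ≤ r)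
    (s : Finset ι) :
    |∫ ω, (∑ i ∈ s, X i ω) ^ k ∂P| ≤ (k * (1 + M)) ^ k * √(s.card : ℝ) ^ k := by
  classical
  induction k using Nat.strong_induction_on generalizing s with
  | _ k ih =>
  match k, ih with
  | 0, _ => simp
  | 1, _ =>
    rcases s.eq_empty_or_nonempty with rfl | ⟨a, -⟩
    · simp
    have hM := hX.bound_nonneg a
    have hint (i : ι) : Integrable (X i) P := by
      simpa using integrable_pow_of_memLp (hX.memLp i) hk
    simp only [pow_one, integral_finsetSum _ fun i _ => hint i, hX.integral_eq_zero,
      Finset.sum_const_zero, abs_zero]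
    positivity
  | l + 2, ih =>
    set D : ℝ := ((l + 2 : ℕ) * (1 + M)) ^ (l + 2)
    suffices h : ∀ t : Finset ι, t.card ≤ s.card →
        |∫ ω, (∑ i ∈ t, X i ω) ^ (l + 2) ∂P| ≤ t.card * (D * √(s.card : ℝ) ^ l) by
      refine (h s le_rfl).trans_eq ?_
      rw [pow_add, Real.sq_sqrt (by positivity)]
      ring
    intro t
    induction t using Finset.induction_on with
    | empty => simp
    | insert a t ha iht =>
      intro hts
      rw [Finset.card_insert_of_notMem ha] at hts ⊢
      have hstep := hX.abs_integral_sum_insert_pow_le hk ha hts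
        fun j hj => ih j (by omega) (by omega) t
      push_cast
      linarith [iht (by omega)]

theorem IsNoise.integral_sum_pow_le {q : ℕ} (hX : IsNoise X (2 * q) M P) (s : Finset ι) :
    ∫ ω, (∑ i ∈ s, X i ω) ^ (2 * q) ∂P ≤ ((2 * q : ℕ) * (1 + M)) ^ (2 * q) * (s.card : ℝ) ^ q := by
  refine (le_abs_self _).trans ((hX.abs_integral_sum_pow_le le_rfl s).trans_eq ?_)
  rw [pow_mul √_, Real.sq_sqrt (by positivity)]

end Noise

section AlmostSure

variable {Ω : Type*} [MeasurableSpace Ω] {P : Measure Ω}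

theorem ae_isLittleO_of_integral_norm_isBigO {Z : ℕ → Ω → ℝ} {a u : ℕ → ℝ}
    (hZ : ∀ n, Integrable (Z n) P) (ha : ∀ᶠ n in atTop, a n ≠ 0) (hu : Summable u)
    (hZu : (fun n => ∫ ω, ‖Z n ω‖ ∂P) =O[atTop] fun n => a n * u n) :
    ∀ᵐ ω ∂P, (fun n => Z n ω) =o[atTop] a := by
  have hnorm (n : ℕ) : ∫ ω, ‖Z n ω / a n‖ ∂P = (∫ ω, ‖Z n ω‖ ∂P) * ‖a n‖⁻¹ := by
    simp_rw [norm_div, div_eq_mul_inv, integral_mul_const]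
  have hsum : Summable fun n => ∫ ω, ‖Z n ω / a n‖ ∂P := by
    refine summable_of_isBigO_nat hu ?_
    simp_rw [hnorm]
    refine (hZu.mul (isBigO_refl (fun n => ‖a n‖⁻¹) atTop)).trans (IsBigO.of_bound' ?_)
    filter_upwards [ha] with n hn
    have hne : ‖a n‖ ≠ 0 := norm_ne_zero_iff.2 hn
    rw [norm_mul, norm_mul, norm_inv, norm_norm, mul_right_comm, mul_inv_cancel₀ hne, one_mul]
  have htsum : ∑' n, eLpNorm (fun ω => Z n ω / a n) 1 P ≠ ⊤ := by
    simp_rw [eLpNorm_one_eq_lintegral_enorm,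
      ← ofReal_integral_norm_eq_lintegral_enorm ((hZ _).div_const _)]
    exact hsum.tsum_ofReal_ne_top
  filter_upwards [summable_norm_of_tsum_eLpNorm_ne_top le_rfl
    (fun n => ((hZ n).div_const (a n)).1) htsum] with ω hω
  exact isLittleO_of_tendsto' (ha.mono fun n hn h => absurd h hn)
    (tendsto_zero_iff_norm_tendsto_zero.2 hω.tendsto_atTop_zero)

variable {m : ℕ → ℕ} {M : ℝ} {q : ℕ} {X : (n : ℕ) → Fin (m n) → Ω → ℝ}

theorem tendsto_of_natCast_isBigO (hm : (fun n : ℕ => (n : ℝ)) =O[atTop] fun n => (m n : ℝ)) :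
    Tendsto m atTop atTop := by
  rw [← tendsto_natCast_atTop_iff (R := ℝ)]
  simpa using hm.trans_tendsto_norm_atTop (by simpa using tendsto_natCast_atTop_atTop)

theorem rpow_isBigO_rpow_mul_inv_sq
    (hm : (fun n : ℕ => (n : ℝ)) =O[atTop] fun n => (m n : ℝ)) {u v : ℝ} (huv : u + 2 ≤ v) :
    (fun n => (m n : ℝ) ^ u) =O[atTop] fun n => (m n : ℝ) ^ v * ((n : ℝ) ^ 2)⁻¹ := by
  have hinv : (fun n => ((m n : ℝ) ^ 2)⁻¹) =O[atTop] fun n : ℕ => ((n : ℝ) ^ 2)⁻¹ :=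
    (hm.pow 2).inv_rev <| (eventually_gt_atTop 0).mono fun n hn h => by simp_all
  refine IsBigO.trans (IsBigO.of_norm_eventuallyLE ?_)
    ((isBigO_refl (fun n => (m n : ℝ) ^ v) atTop).mul hinv)
  filter_upwards [(tendsto_of_natCast_isBigO hm).eventually_ge_atTop 1] with n hn
  have hn' : (1 : ℝ) ≤ m n := by exact_mod_cast hn
  rw [Real.norm_of_nonneg (by positivity), ← Real.rpow_natCast, ← Real.rpow_neg (by positivity),
    ← Real.rpow_add (by positivity)]
  exact Real.rpow_le_rpow_of_exponent_le hn' (by push_cast; linarith)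

theorem ae_isLittleO_rpow_of_integral_pow_le
    (hm : (fun n : ℕ => (n : ℝ)) =O[atTop] fun n => (m n : ℝ)) {p : ℕ} (hp : p ≠ 0)
    {Z : ℕ → Ω → ℝ} (hZ : ∀ n, Integrable (fun ω => ‖Z n ω‖ ^ p) P) {C u v : ℝ}
    (hZu : ∀ n, ∫ ω, ‖Z n ω‖ ^ p ∂P ≤ C * (m n : ℝ) ^ u) (huv : u + 2 ≤ v * p) :
    ∀ᵐ ω ∂P, (fun n => Z n ω) =o[atTop] fun n => (m n : ℝ) ^ v := by
  have hpow (n : ℕ) : ((m n : ℝ) ^ v) ^ p = (m n : ℝ) ^ (v * p) := by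
    rw [Real.rpow_mul (by positivity), Real.rpow_natCast]
  have hO : (fun n => ∫ ω, ‖‖Z n ω‖ ^ p‖ ∂P) =O[atTop]
      fun n => ((m n : ℝ) ^ v) ^ p * ((n : ℝ) ^ 2)⁻¹ := by
    simp_rw [hpow, norm_pow, norm_norm]
    refine IsBigO.trans (IsBigO.of_bound C (.of_forall fun n => ?_))
      (rpow_isBigO_rpow_mul_inv_sq hm huv)
    rw [Real.norm_of_nonneg (by positivity), Real.norm_of_nonneg (by positivity)]
    exact hZu n
  have hne : ∀ᶠ n in atTop, ((m n : ℝ) ^ v) ^ p ≠ 0 := by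
    filter_upwards [(tendsto_of_natCast_isBigO hm).eventually_gt_atTop 0] with n hn
    positivity
  filter_upwards [ae_isLittleO_of_integral_norm_isBigO hZ hne
    (Real.summable_nat_pow_inv.2 one_lt_two) hO] with ω hω
  simp_rw [← norm_pow] at hω
  exact IsLittleO.of_pow (n := p) hω.of_norm_left hp

variable [IsProbabilityMeasure P]

theorem ae_sum_isLittleO_rpow (hX : ∀ n, IsNoise (X n) (2 * q) M P)
    (hm : (fun n : ℕ => (n : ℝ)) =O[atTop] fun n => (m n : ℝ)) {v : ℝ} (hv : 2 ≤ q * (2 * v - 1)) :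
    ∀ᵐ ω ∂P, (fun n => ∑ i, X n i ω) =o[atTop] fun n => (m n : ℝ) ^ v := by
  have hq : 2 * q ≠ 0 := fun h => by
    rw [(by omega : q = 0)] at hv
    norm_num at hv
  refine ae_isLittleO_rpow_of_integral_pow_le hm hq
    (C := ((2 * q : ℕ) * (1 + M)) ^ (2 * q)) (u := q)
    (fun n => ((hX n).memLp_sum le_rfl Finset.univ).integrable_norm_pow') (fun n => ?_)
    (by push_cast; linarith)
  simp_rw [← norm_pow, Real.norm_of_nonneg ((even_two_mul q).pow_nonneg _), Real.rpow_natCast]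
  simpa only [Finset.card_fin] using (hX n).integral_sum_pow_le Finset.univ

theorem sum_sq_pow_le {ι : Type*} (s : Finset ι) (x : ι → ℝ) (l : ℕ) :
    (∑ i ∈ s, x i ^ 2) ^ (l + 1) ≤ (s.card : ℝ) ^ l * ∑ i ∈ s, |x i| ^ (2 * (l + 1)) := by
  simpa only [pow_mul, sq_abs] using
    pow_sum_le_card_mul_sum_pow (s := s) (f := fun i => x i ^ 2) (fun i _ => sq_nonneg _) (n := l)

theorem ae_sum_sq_isLittleO_rpow (hX : ∀ n, IsNoise (X n) (2 * q) M P)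
    (hm : (fun n : ℕ => (n : ℝ)) =O[atTop] fun n => (m n : ℝ)) {v : ℝ} (hv : 2 ≤ q * (v - 1)) :
    ∀ᵐ ω ∂P, (fun n => ∑ i, X n i ω ^ 2) =o[atTop] fun n => (m n : ℝ) ^ v := by
  obtain _ | l := q
  · norm_num at hv
  have habs (n : ℕ) (i : Fin (m n)) : Integrable (fun ω => |X n i ω| ^ (2 * (l + 1))) P :=
    ((hX n).memLp i).integrable_norm_pow'
  have hdom (n : ℕ) :
      Integrable (fun ω => (m n : ℝ) ^ l * ∑ i, |X n i ω| ^ (2 * (l + 1))) P :=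
    (integrable_finsetSum _ fun i _ => habs n i).const_mul _
  have hle (n : ℕ) (ω : Ω) : ‖∑ i, X n i ω ^ 2‖ ^ (l + 1) ≤
      (m n : ℝ) ^ l * ∑ i, |X n i ω| ^ (2 * (l + 1)) := by
    rw [Real.norm_of_nonneg (by positivity)]
    simpa only [Finset.card_fin] using sum_sq_pow_le Finset.univ (fun i => X n i ω) l
  have hint (n : ℕ) : Integrable (fun ω => ‖∑ i, X n i ω ^ 2‖ ^ (l + 1)) P := by
    refine (hdom n).mono' ?_ (ae_of_all _ fun ω => by simpa using hle n ω)
    have hmeas : AEStronglyMeasurable (fun ω => ∑ i, X n i ω ^ 2) P :=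
      Finset.aestronglyMeasurable_fun_sum _ fun i _ => ((hX n).memLp i).1.pow 2
    exact hmeas.norm.pow _
  refine ae_isLittleO_rpow_of_integral_pow_le hm l.succ_ne_zero (C := M) (u := (l + 1 : ℕ)) hint
    (fun n => ?_) (by linarith)
  calc ∫ ω, ‖∑ i, X n i ω ^ 2‖ ^ (l + 1) ∂P
      ≤ ∫ ω, (m n : ℝ) ^ l * ∑ i, |X n i ω| ^ (2 * (l + 1)) ∂P :=
        integral_mono (hint n) (hdom n) (hle n)
    _ = (m n : ℝ) ^ l * ∑ i, ∫ ω, |X n i ω| ^ (2 * (l + 1)) ∂P := by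
        rw [integral_const_mul, integral_finsetSum _ fun i _ => habs n i]
    _ ≤ (m n : ℝ) ^ l * ∑ _i : Fin (m n), M := by
        gcongr with i
        exact (hX n).integral_abs_pow_le i
    _ = M * (m n : ℝ) ^ ((l + 1 : ℕ) : ℝ) := by
        rw [Finset.sum_const, nsmul_eq_mul, Finset.card_fin, Real.rpow_natCast]
        ring

theorem ae_sum_sum_Icc_pow_isLittleO_rpow (hX : ∀ n, IsNoise (X n) (2 * q) M P)
    (hm : (fun n : ℕ => (n : ℝ)) =O[atTop] fun n => (m n : ℝ)) {v : ℝ} (hv : q + 4 ≤ v) :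
    ∀ᵐ ω ∂P, (fun n => ∑ j, ∑ k, (∑ i ∈ Finset.Icc j k, X n i ω) ^ (2 * q)) =o[atTop]
      fun n => (m n : ℝ) ^ v := by
  set C : ℝ := ((2 * q : ℕ) * (1 + M)) ^ (2 * q)
  have hC : 0 ≤ C := (even_two_mul q).pow_nonneg _
  have hint (n : ℕ) (j k : Fin (m n)) :
      Integrable (fun ω => (∑ i ∈ Finset.Icc j k, X n i ω) ^ (2 * q)) P :=
    integrable_pow_of_memLp ((hX n).memLp_sum le_rfl _) le_rfl
  have hmom (n : ℕ) (j k : Fin (m n)) :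
      ∫ ω, (∑ i ∈ Finset.Icc j k, X n i ω) ^ (2 * q) ∂P ≤ C * (m n : ℝ) ^ q :=
    ((hX n).integral_sum_pow_le _).trans <| by
      gcongr
      exact card_finset_fin_le _
  refine ae_isLittleO_rpow_of_integral_pow_le hm one_ne_zero (C := C) (u := (q + 2 : ℕ))
    (fun n => ?_) (fun n => ?_) (by push_cast; linarith)
  · simp only [pow_one]
    exact (integrable_finsetSum _ fun j _ => integrable_finsetSum _ fun k _ => hint n j k).norm
  have hnonneg (ω : Ω) : 0 ≤ ∑ j, ∑ k, (∑ i ∈ Finset.Icc j k, X n i ω) ^ (2 * q) :=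
    Finset.sum_nonneg fun j _ => Finset.sum_nonneg fun k _ => (even_two_mul q).pow_nonneg _
  calc ∫ ω, ‖∑ j, ∑ k, (∑ i ∈ Finset.Icc j k, X n i ω) ^ (2 * q)‖ ^ 1 ∂P
      = ∑ j, ∑ k, ∫ ω, (∑ i ∈ Finset.Icc j k, X n i ω) ^ (2 * q) ∂P := by
        simp_rw [pow_one, Real.norm_of_nonneg (hnonneg _)]
        rw [integral_finsetSum _ fun j _ => integrable_finsetSum _ fun k _ => hint n j k]
        exact Finset.sum_congr rfl fun j _ => integral_finsetSum _ fun k _ => hint n j k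
    _ ≤ ∑ _j : Fin (m n), ∑ _k : Fin (m n), C * (m n : ℝ) ^ q :=
        Finset.sum_le_sum fun j _ => Finset.sum_le_sum fun k _ => hmom n j k
    _ = C * (m n : ℝ) ^ ((q + 2 : ℕ) : ℝ) := by
        simp only [Finset.sum_const, Finset.card_fin, nsmul_eq_mul, Real.rpow_natCast]
        ring

theorem ae_eventually_abs_sum_Icc_le (hX : ∀ n, IsNoise (X n) (2 * q) M P)
    (hm : (fun n : ℕ => (n : ℝ)) =O[atTop] fun n => (m n : ℝ)) (hq : 4 ≤ q) :
    ∀ᵐ ω ∂P, ∀ δ > 0, ∀ᶠ n in atTop, ∀ j k : Fin (m n),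
      |∑ i ∈ Finset.Icc j k, X n i ω| ≤ δ * m n := by
  have hq' : (4 : ℝ) ≤ q := by exact_mod_cast hq
  filter_upwards [ae_sum_sum_Icc_pow_isLittleO_rpow hX hm (v := (2 * q : ℕ))
    (by push_cast; linarith)] with ω hω δ hδ
  filter_upwards [hω.bound (c := δ ^ (2 * q)) (by positivity)] with n hn j k
  have hnonneg (j k : Fin (m n)) : 0 ≤ (∑ i ∈ Finset.Icc j k, X n i ω) ^ (2 * q) :=
    (even_two_mul q).pow_nonneg _
  refine le_of_pow_le_pow_left₀ (by omega : 2 * q ≠ 0) (by positivity) ?_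
  calc |∑ i ∈ Finset.Icc j k, X n i ω| ^ (2 * q)
      = (∑ i ∈ Finset.Icc j k, X n i ω) ^ (2 * q) := (even_two_mul q).pow_abs _
    _ ≤ ∑ k, (∑ i ∈ Finset.Icc j k, X n i ω) ^ (2 * q) :=
        Finset.single_le_sum (fun k _ => hnonneg j k) (Finset.mem_univ k)
    _ ≤ ∑ j, ∑ k, (∑ i ∈ Finset.Icc j k, X n i ω) ^ (2 * q) :=
        Finset.single_le_sum (fun j _ => Finset.sum_nonneg fun k _ => hnonneg j k)
          (Finset.mem_univ j)
    _ ≤ δ ^ (2 * q) * ‖(m n : ℝ) ^ ((2 * q : ℕ) : ℝ)‖ := (le_abs_self _).trans hn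
    _ = (δ * m n) ^ (2 * q) := by
        rw [Real.rpow_natCast, Real.norm_of_nonneg (by positivity), mul_pow]

end AlmostSure

section Isotonic

theorem exists_pos_monotoneOn_sub_eq_ite {ι : Type*} [Finite ι] {fhat : ℝ → ℝ} {s : Set ℝ}
    (hfhat : MonotoneOn fhat s) (x : ι → ℝ) (a c : ℝ) :
    ∃ t > 0, ∃ h : ℝ → ℝ, MonotoneOn h s ∧
      ∀ i, h (x i) - fhat (x i) = if a ≤ x i ∧ fhat (x i) ≤ c then t else 0 := by
  -- `t` is smaller than the gap between `c` and the fitted values above `c`.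
  obtain ⟨t, hgap, ht⟩ : ∃ t : ℝ, (∀ i, c < fhat (x i) → c + t < fhat (x i)) ∧ 0 < t := by
    have hpos : ∀ᶠ t in 𝓝[>] (0 : ℝ), 0 < t := self_mem_nhdsWithin
    refine ((eventually_all.2 fun i => ?_).and hpos).exists
    by_cases hi : c < fhat (x i)
    · filter_upwards [nhdsWithin_le_nhds (Iio_mem_nhds (sub_pos.2 hi))] with t ht _
      linarith [mem_Iio.1 ht]
    · exact .of_forall fun _ h => absurd h hi
  set h : ℝ → ℝ := fun y => if a ≤ y then max (fhat y) (min (fhat y + t) (c + t)) else fhat y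
  refine ⟨t, ht, h, fun y hy z hz hyz => ?_, fun i => ?_⟩
  · have hyz' := hfhat hy hz hyz
    by_cases hay : a ≤ y
    · simp only [h, if_pos hay, if_pos (hay.trans hyz)]
      gcongr
    · simp only [h, if_neg hay]
      split_ifs
      · exact hyz'.trans (le_max_left _ _)
      · exact hyz'
  · by_cases hax : a ≤ x i
    · by_cases hfc : fhat (x i) ≤ c
      · simp only [h, if_pos hax, if_pos (And.intro hax hfc)]
        rw [min_eq_left (by linarith), max_eq_right (by linarith), add_sub_cancel_left]
      · have := hgap i (not_le.1 hfc)
        simp only [h, if_pos hax, hfc, and_false, if_false]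
        rw [min_eq_right (by linarith), max_eq_left (by linarith), sub_self]
    · simp [h, hax]

namespace IsIsotonicRegression

variable {m : ℕ} {x Y : Fin m → ℝ} {fhat : ℝ → ℝ}

theorem sum_mul_sub_nonpos (hfit : IsIsotonicRegression x Y fhat) {h : ℝ → ℝ}
    (hh : MonotoneOn h (Icc 0 1)) :
    ∑ i, (Y i - fhat (x i)) * (h (x i) - fhat (x i)) ≤ 0 := by
  set A := ∑ i, (Y i - fhat (x i)) * (h (x i) - fhat (x i))
  set B := ∑ i, (h (x i) - fhat (x i)) ^ 2
  have hB : 0 ≤ B := Finset.sum_nonneg fun i _ => sq_nonneg _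
  have hline (t : ℝ) (ht₀ : 0 ≤ t) (ht₁ : t ≤ 1) : 2 * t * A ≤ t ^ 2 * B := by
    have hmono : MonotoneOn (fun y => (1 - t) * fhat y + t * h y) (Icc 0 1) :=
      fun y hy z hz hyz => add_le_add
        (mul_le_mul_of_nonneg_left (hfit.1 hy hz hyz) (sub_nonneg.2 ht₁))
        (mul_le_mul_of_nonneg_left (hh hy hz hyz) ht₀)
    have hexpand : ∑ i, (Y i - ((1 - t) * fhat (x i) + t * h (x i))) ^ 2 =
        ∑ i, (Y i - fhat (x i)) ^ 2 - 2 * t * A + t ^ 2 * B := by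
      simp_rw [A, B, Finset.mul_sum, ← Finset.sum_sub_distrib, ← Finset.sum_add_distrib]
      exact Finset.sum_congr rfl fun i _ => by ring
    linarith [hfit.2 _ hmono]
  by_contra! hA
  have hmin := hline (A / (A + B)) (by positivity) (div_le_one_of_le₀ (by linarith) (by linarith))
  have hAB : 0 < A + B := by linarith
  field_simp at hmin
  nlinarith

theorem sum_le_mul_card (hfit : IsIsotonicRegression x Y fhat) (a c : ℝ) :
    ∑ i with a ≤ x i ∧ fhat (x i) ≤ c, Y i ≤
      c * (Finset.univ.filter fun i => a ≤ x i ∧ fhat (x i) ≤ c).card := by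
  obtain ⟨t, ht, h, hh, hdiff⟩ := exists_pos_monotoneOn_sub_eq_ite hfit.1 x a c
  have hblock := hfit.sum_mul_sub_nonpos hh
  simp only [hdiff, mul_ite, mul_zero] at hblock
  rw [← Finset.sum_filter, ← Finset.sum_mul, Finset.sum_sub_distrib] at hblock
  have hfhat : ∑ i with a ≤ x i ∧ fhat (x i) ≤ c, fhat (x i) ≤
      c * (Finset.univ.filter fun i => a ≤ x i ∧ fhat (x i) ≤ c).card := by
    rw [mul_comm, ← nsmul_eq_mul]
    exact Finset.sum_le_card_nsmul _ _ _ fun i hi => (Finset.mem_filter.1 hi).2.2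
  linarith [nonpos_of_mul_nonpos_left hblock ht]

theorem ordConnected_filter (hfit : IsIsotonicRegression x Y fhat)
    (hx : Monotone x ∨ Antitone x) (hx01 : ∀ i, x i ∈ Icc (0 : ℝ) 1) (a c : ℝ) :
    ((Finset.univ.filter fun i => a ≤ x i ∧ fhat (x i) ≤ c : Finset (Fin m)) :
      Set (Fin m)).OrdConnected := by
  have hs : {y | y ∈ Icc (0 : ℝ) 1 ∧ a ≤ y ∧ fhat y ≤ c}.OrdConnected :=
    ⟨fun y hy z hz w hw => ⟨Icc_subset_Icc hy.1.1 hz.1.2 hw, hy.2.1.trans hw.1,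
      (hfit.1 (Icc_subset_Icc hy.1.1 hz.1.2 hw) hz.1 hw.2).trans hz.2.2⟩⟩
  convert hx.elim hs.preimage_mono hs.preimage_anti using 1
  ext i
  simp [(hx01 i).1, (hx01 i).2]

theorem reflect (hfit : IsIsotonicRegression x Y fhat) :
    IsIsotonicRegression (fun i => 1 - x i) (fun i => -Y i) (fun t => -fhat (1 - t)) := by
  have hrefl (g : ℝ → ℝ) (hg : MonotoneOn g (Icc 0 1)) :
      MonotoneOn (fun t => -g (1 - t)) (Icc 0 1) := fun y hy z hz hyz =>
    neg_le_neg (hg (Icc.one_sub_mem hz) (Icc.one_sub_mem hy) (by linarith))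
  refine ⟨hrefl _ hfit.1, fun g hg => ?_⟩
  convert hfit.2 _ (hrefl g hg) using 2 with i _ i _
  · simp only [sub_sub_cancel]
    ring
  · ring

end IsIsotonicRegression

theorem eq_Icc_of_ordConnected {α : Type*} [LinearOrder α] [LocallyFiniteOrder α] {B : Finset α}
    (hB : (B : Set α).OrdConnected) (hne : B.Nonempty) :
    B = Finset.Icc (B.min' hne) (B.max' hne) := by
  ext i
  rw [Finset.mem_Icc]
  exact ⟨fun hi => ⟨B.min'_le i hi, B.le_max' i hi⟩,
    fun hi => hB.out (B.min'_mem hne) (B.max'_mem hne) hi⟩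

theorem IsIsotonicRegression.lt_apply {m : ℕ} {x e : Fin m → ℝ} {f fhat : ℝ → ℝ}
    (hfit : IsIsotonicRegression x (fun i => f (x i) + e i) fhat)
    (hx : Monotone x ∨ Antitone x) (hx01 : ∀ i, x i ∈ Icc (0 : ℝ) 1)
    (hf : MonotoneOn f (Icc 0 1)) {d c b : ℝ} (hd : 0 ≤ d) (hdc : d ≤ c) (hcb : c ≤ b)
    (hb : b ≤ 1) {r : ℝ} (hr₀ : 0 ≤ r)
    (hr : r < (f c - f d) * (Finset.univ.filter fun i => x i ∈ Icc c b).card)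
    (he : ∀ j k, |∑ i ∈ Finset.Icc j k, e i| ≤ r) :
    f d < fhat b := by
  have hc' : c ∈ Icc (0 : ℝ) 1 := ⟨hd.trans hdc, hcb.trans hb⟩
  have hd' : d ∈ Icc (0 : ℝ) 1 := ⟨hd, hdc.trans hc'.2⟩
  by_contra! hle
  set B : Finset (Fin m) := {i | d ≤ x i ∧ fhat (x i) ≤ f d}
  set A : Finset (Fin m) := {i | x i ∈ Icc c b}
  have hAB : A ⊆ B := Finset.monotone_filter_right _ fun i _ hi =>
    ⟨hdc.trans hi.1, (hfit.1 (hx01 i) ⟨by linarith, hb⟩ hi.2).trans hle⟩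
  have hord : (B : Set (Fin m)).OrdConnected := hfit.ordConnected_filter hx hx01 d (f d)
  have hne : B.Nonempty := by
    have hcard := pos_of_mul_pos_right (hr₀.trans_lt hr) (sub_nonneg.2 (hf hd' hc' hdc))
    exact (Finset.card_pos.1 (Nat.cast_pos.1 hcard)).mono hAB
  have hblock : ∑ i ∈ B, (f (x i) - f d) + ∑ i ∈ B, e i ≤ 0 := by
    have := hfit.sum_le_mul_card d (f d)
    rw [Finset.sum_add_distrib, mul_comm] at this
    rw [Finset.sum_sub_distrib, Finset.sum_const, nsmul_eq_mul]
    linarith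
  have hsignal : (f c - f d) * A.card ≤ ∑ i ∈ B, (f (x i) - f d) := calc
    (f c - f d) * A.card = A.card • (f c - f d) := by rw [nsmul_eq_mul, mul_comm]
    _ ≤ ∑ i ∈ A, (f (x i) - f d) := Finset.card_nsmul_le_sum _ _ _ fun i hi =>
      sub_le_sub_right (hf hc' (hx01 i) (Finset.mem_filter.1 hi).2.1) _
    _ ≤ ∑ i ∈ B, (f (x i) - f d) := Finset.sum_le_sum_of_subset_of_nonneg hAB fun i hi _ =>
      sub_nonneg.2 (hf hd' (hx01 i) (Finset.mem_filter.1 hi).2.1)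
  have hnoise := he (B.min' hne) (B.max' hne)
  rw [← eq_Icc_of_ordConnected hord hne] at hnoise
  linarith [neg_le_of_abs_le hnoise]

end Isotonic

section Consistency

variable {m : ℕ → ℕ} {x e : (n : ℕ) → Fin (m n) → ℝ} {f : ℝ → ℝ} {fhat : ℕ → ℝ → ℝ}

/-- Every nondegenerate closed subinterval of `[0,1]` contains asymptotically a positive fraction
of the design points `x n i`, `i < m n`. The strict inequality makes the rows eventually
nonempty. -/
def IsAsymptoticallyDense (x : (n : ℕ) → Fin (m n) → ℝ) : Prop :=
  ∀ a b, 0 ≤ a → a < b → b ≤ 1 → ∃ κ > (0 : ℝ), ∀ᶠ n in atTop,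
    κ * m n < (Finset.univ.filter fun i => x n i ∈ Icc a b).card

theorem IsAsymptoticallyDense.one_sub (hx : IsAsymptoticallyDense x) :
    IsAsymptoticallyDense fun n i => 1 - x n i := by
  intro a b ha hab hb
  simpa only [sub_mem_Icc_iff_right] using
    hx (1 - b) (1 - a) (by linarith) (by linarith) (by linarith)

theorem eventually_lt_apply (hmono : ∀ n, Monotone (x n) ∨ Antitone (x n))
    (hx01 : ∀ n i, x n i ∈ Icc (0 : ℝ) 1) (hdense : IsAsymptoticallyDense x)
    (hf : StrictMonoOn f (Icc 0 1))
    (he : ∀ δ > 0, ∀ᶠ n in atTop, ∀ j k, |∑ i ∈ Finset.Icc j k, e n i| ≤ δ * m n)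
    (hfhat : ∀ n, IsIsotonicRegression (x n) (fun i => f (x n i) + e n i) (fhat n))
    {d b : ℝ} (hd : 0 ≤ d) (hdb : d < b) (hb : b ≤ 1) :
    ∀ᶠ n in atTop, f d < fhat n b := by
  obtain ⟨c, hdc, hcb⟩ := exists_between hdb
  obtain ⟨κ, hκ, hcount⟩ := hdense c b (hd.trans hdc.le) hcb hb
  have hgap : 0 < f c - f d :=
    sub_pos.2 (hf ⟨hd, hdb.le.trans hb⟩ ⟨hd.trans hdc.le, hcb.le.trans hb⟩ hdc)
  filter_upwards [hcount, he _ (mul_pos hgap hκ)] with n hcount he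
  refine (hfhat n).lt_apply (hmono n) (hx01 n) hf.monotoneOn hd hdc.le hcb.le hb (by positivity)
    ?_ he
  rw [mul_assoc]
  exact mul_lt_mul_of_pos_left hcount hgap

theorem eventually_apply_lt (hmono : ∀ n, Monotone (x n) ∨ Antitone (x n))
    (hx01 : ∀ n i, x n i ∈ Icc (0 : ℝ) 1) (hdense : IsAsymptoticallyDense x)
    (hf : StrictMonoOn f (Icc 0 1))
    (he : ∀ δ > 0, ∀ᶠ n in atTop, ∀ j k, |∑ i ∈ Finset.Icc j k, e n i| ≤ δ * m n)
    (hfhat : ∀ n, IsIsotonicRegression (x n) (fun i => f (x n i) + e n i) (fhat n))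
    {d a : ℝ} (ha : 0 ≤ a) (had : a < d) (hd : d ≤ 1) :
    ∀ᶠ n in atTop, fhat n a < f d := by
  have hrefl : StrictMonoOn (fun t => -f (1 - t)) (Icc 0 1) := fun y hy z hz hyz =>
    neg_lt_neg (hf (Icc.one_sub_mem hz) (Icc.one_sub_mem hy) (by linarith))
  have hfit (n : ℕ) : IsIsotonicRegression (fun i => 1 - x n i)
      (fun i => -f (1 - (1 - x n i)) + -e n i) (fun t => -fhat n (1 - t)) := by
    simpa only [sub_sub_cancel, neg_add] using (hfhat n).reflect
  have hlt := eventually_lt_apply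
    (fun n => (hmono n).symm.imp (fun h i j hij => sub_le_sub_left (h hij) 1)
      fun h i j hij => sub_le_sub_left (h hij) 1)
    (fun n i => Icc.one_sub_mem (hx01 n i)) hdense.one_sub hrefl
    (by simpa only [Finset.sum_neg_distrib, abs_neg] using he) hfit
    (sub_nonneg.2 hd) (sub_lt_sub_left had 1) (sub_le_self 1 ha)
  simpa only [sub_sub_cancel, neg_lt_neg_iff] using hlt

theorem genInverse_mem_Icc {fhat : ℝ → ℝ} (hmono : MonotoneOn fhat (Icc 0 1)) {θ a b : ℝ}
    (ha : a ∈ Icc (0 : ℝ) 1) (hb : b ∈ Icc (0 : ℝ) 1) (hfa : fhat a < θ) (hfb : θ ≤ fhat b) :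
    genInverse fhat θ ∈ Icc a b := by
  refine ⟨le_csInf ⟨b, hb, hfb⟩ fun t ht => ?_, csInf_le ⟨0, fun t ht => ht.1.1⟩ ⟨hb, hfb⟩⟩
  by_contra! hta
  exact (hmono ht.1 ha hta.le).not_gt (hfa.trans_le ht.2)

theorem tendsto_genInverse (hmono : ∀ n, Monotone (x n))
    (hx01 : ∀ n i, x n i ∈ Icc (0 : ℝ) 1) (hdense : IsAsymptoticallyDense x)
    (hf : StrictMonoOn f (Icc 0 1))
    (he : ∀ δ > 0, ∀ᶠ n in atTop, ∀ j k, |∑ i ∈ Finset.Icc j k, e n i| ≤ δ * m n)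
    (hfhat : ∀ n, IsIsotonicRegression (x n) (fun i => f (x n i) + e n i) (fhat n))
    {d₀ : ℝ} (hd₀ : d₀ ∈ Ioo (0 : ℝ) 1) :
    Tendsto (fun n => genInverse (fhat n) (f d₀)) atTop (𝓝 d₀) := by
  have hmem {a b : ℝ} (ha : 0 ≤ a) (had : a < d₀) (hdb : d₀ < b) (hb : b ≤ 1) :
      ∀ᶠ n in atTop, genInverse (fhat n) (f d₀) ∈ Icc a b := by
    filter_upwards [
      eventually_apply_lt (fun n => .inl (hmono n)) hx01 hdense hf he hfhat ha had hd₀.2.le,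
      eventually_lt_apply (fun n => .inl (hmono n)) hx01 hdense hf he hfhat hd₀.1.le hdb hb]
      with n hlow hup
    exact genInverse_mem_Icc (hfhat n).1 ⟨ha, (had.trans hd₀.2).le⟩ ⟨(hd₀.1.trans hdb).le, hb⟩
      hlow hup.le
  refine tendsto_order.2 ⟨fun a ha => ?_, fun b hb => ?_⟩
  · obtain ⟨a', ha', had⟩ := exists_between (max_lt ha hd₀.1)
    filter_upwards [hmem ((le_max_right _ _).trans ha'.le) had hd₀.2 le_rfl] with n hn
    exact (le_max_left _ _).trans_lt (ha'.trans_le hn.1)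
  · obtain ⟨b', hdb, hb'⟩ := exists_between (lt_min hb hd₀.2)
    filter_upwards [hmem le_rfl hd₀.1 hdb (hb'.le.trans (min_le_right _ _))] with n hn
    exact (hn.2.trans_lt hb').trans_le (min_le_left _ _)

end Consistency

section Design

theorem measureReal_withDensity_pos {g : ℝ → ℝ} (hgm : Measurable g)
    [IsFiniteMeasure (volume.withDensity fun t => ENNReal.ofReal (g t))] {s : Set ℝ}
    (hs : MeasurableSet s) (hg : ∀ t ∈ s, 0 < g t) (hvol : 0 < volume s) :
    0 < (volume.withDensity fun t => ENNReal.ofReal (g t)).real s := by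
  refine ENNReal.toReal_pos (ne_of_gt ?_) (measure_ne_top _ _)
  rw [withDensity_apply _ hs, setLIntegral_pos_iff (by fun_prop)]
  exact hvol.trans_le (measure_mono fun t ht => ⟨by simpa using hg t ht, ht⟩)

theorem empiricalCDF_sub_le {m : ℕ} (x : Fin m → ℝ) (a b : ℝ) :
    empiricalCDF x b - empiricalCDF x a ≤
      (Finset.univ.filter fun i => x i ∈ Icc a b).card / (m : ℝ) := by
  have hsub : (Finset.univ.filter fun i => x i ≤ b) ⊆
      (Finset.univ.filter fun i => x i ∈ Icc a b) ∪ Finset.univ.filter fun i => x i ≤ a := by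
    intro i
    simp only [Finset.mem_filter, Finset.mem_union, Finset.mem_univ, true_and]
    exact fun hb => (le_total a (x i)).imp (⟨·, hb⟩) id
  rw [empiricalCDF, empiricalCDF, sub_le_iff_le_add, ← add_div]
  gcongr
  exact_mod_cast (Finset.card_le_card hsub).trans (Finset.card_union_le _ _)

theorem tendsto_empiricalCDF {x : (m : ℕ) → Fin m → ℝ} {F : ℝ → ℝ} {C : ℝ}
    (hC : ∀ m : ℕ, 0 < m → ∀ t ∈ Icc (0 : ℝ) 1,
      |empiricalCDF (x m) t - F t| ≤ C * (m : ℝ) ^ (-(1 / 2) : ℝ))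
    {t : ℝ} (ht : t ∈ Icc (0 : ℝ) 1) :
    Tendsto (fun m => empiricalCDF (x m) t) atTop (𝓝 (F t)) := by
  have hlim : Tendsto (fun m : ℕ => C * (m : ℝ) ^ (-(1 / 2) : ℝ)) atTop (𝓝 0) := by
    simpa using ((tendsto_rpow_neg_atTop one_half_pos).comp
      tendsto_natCast_atTop_atTop).const_mul C
  refine tendsto_iff_dist_tendsto_zero.2 (squeeze_zero' (.of_forall fun _ => dist_nonneg) ?_ hlim)
  filter_upwards [eventually_gt_atTop 0] with m hm
  exact hC m hm t ht

theorem AssumptionA2.isAsymptoticallyDense {x : (m : ℕ) → Fin m → ℝ} (hA2 : AssumptionA2 x) :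
    IsAsymptoticallyDense x := by
  obtain ⟨ν, g, hν, hgm, -, rfl, hg, -, -, C, hC⟩ := hA2
  set ν := volume.withDensity fun t => ENNReal.ofReal (g t)
  intro a b ha hab hb
  have hIoc : ν.real (Ioc a b) = cdf ν b - cdf ν a := by
    rw [cdf_eq_real, cdf_eq_real, ← measureReal_sdiff (Iic_subset_Iic.2 hab.le) measurableSet_Iic,
      Iic_sdiff_Iic]
  have hpos : 0 < cdf ν b - cdf ν a := hIoc ▸ measureReal_withDensity_pos hgm measurableSet_Ioc
    (fun t ht => hg t ⟨ha.trans ht.1.le, ht.2.trans hb⟩) (by simpa using hab)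
  obtain ⟨κ, hκ, hκlt⟩ := exists_between hpos
  have hlim := (tendsto_empiricalCDF hC (t := b) ⟨ha.trans hab.le, hb⟩).sub
    (tendsto_empiricalCDF hC (t := a) ⟨ha, hab.le.trans hb⟩)
  refine ⟨κ, hκ, ?_⟩
  filter_upwards [hlim.eventually_const_lt hκlt, eventually_gt_atTop 0] with m hm hm₀
  rw [← lt_div_iff₀ (by exact_mod_cast hm₀)]
  exact hm.trans_le (empiricalCDF_sub_le _ _ _)

theorem IsAsymptoticallyDense.comp_tendsto {x : (m : ℕ) → Fin m → ℝ}
    (hx : IsAsymptoticallyDense x) {m : ℕ → ℕ} (hm : Tendsto m atTop atTop) :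
    IsAsymptoticallyDense fun n => x (m n) := fun a b ha hab hb =>
  (hx a b ha hab hb).imp fun _ hκ => ⟨hκ.1, hm.eventually hκ.2⟩

theorem AssumptionA3.strictMonoOn {f : ℝ → ℝ} (hf : AssumptionA3 f) :
    StrictMonoOn f (Icc 0 1) := by
  obtain ⟨hd, c, C, hc, hcC⟩ := hf
  refine strictMonoOn_of_deriv_pos (convex_Icc 0 1) hd.continuousOn fun t ht => ?_
  rw [← derivWithin_of_mem_nhds (mem_interior_iff_mem_nhds.1 ht)]
  exact hc.trans_le (hcC t (interior_subset ht)).1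

end Design

section LeastSquares

theorem sum_sub_sq_eq_add_card_mul {ι : Type*} [Fintype ι] (Y : ι → ℝ) (a : ℝ) :
    ∑ i, (Y i - a) ^ 2 =
      ∑ i, (Y i - 𝔼 j, Y j) ^ 2 + Fintype.card ι * (𝔼 j, Y j - a) ^ 2 := by
  set M := 𝔼 j, Y j with hM
  have hsplit (i : ι) : (Y i - a) ^ 2 = (Y i - M) ^ 2 + (2 * (M - a) * Y i + (a ^ 2 - M ^ 2)) := by
    ring
  simp_rw [hsplit]
  rw [Finset.sum_add_distrib, Finset.sum_add_distrib, ← Finset.mul_sum, ← Fintype.card_mul_expect Y,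
    ← hM, Finset.sum_const, Finset.card_univ, nsmul_eq_mul]
  ring

theorem eq_expect_of_forall_sum_sub_sq_le {ι : Type*} [Fintype ι] [Nonempty ι] {Y : ι → ℝ} {a : ℝ}
    (ha : ∀ c, ∑ i, (Y i - a) ^ 2 ≤ ∑ i, (Y i - c) ^ 2) : a = 𝔼 i, Y i := by
  have hle := ha (𝔼 i, Y i)
  rw [sum_sub_sq_eq_add_card_mul Y a, add_le_iff_nonpos_right] at hle
  have hsq := nonpos_of_mul_nonpos_right hle (by exact_mod_cast Fintype.card_pos)
  exact (sub_eq_zero.1 (sq_nonpos_iff _ |>.1 hsq)).symm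

namespace IsLeastSquaresFit

variable {k : ℕ} {L U : ℝ} {Y' Y'' : Fin k → ℝ} {b : ℝ × ℝ}

theorem swap (hb : IsLeastSquaresFit L U Y' Y'' b) : IsLeastSquaresFit U L Y'' Y' b :=
  fun c => by simpa only [add_comm] using hb c

variable [NeZero k]

theorem fst_add_snd_mul_eq_expect (hb : IsLeastSquaresFit L U Y' Y'' b) (hLU : L ≠ U) :
    b.1 + b.2 * U = 𝔼 i, Y'' i := by
  refine eq_expect_of_forall_sum_sub_sq_le fun c => ?_
  -- Compare with the line that has the same value at `L` and the value `c` at `U`.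
  have hslope : (c - (b.1 + b.2 * L)) / (U - L) * (U - L) = c - (b.1 + b.2 * L) :=
    div_mul_cancel₀ _ (sub_ne_zero.2 hLU.symm)
  set t := (c - (b.1 + b.2 * L)) / (U - L)
  have hle := hb (b.1 + b.2 * L - t * L, t)
  have hU : b.1 + b.2 * L - t * L + t * U = c := by linarith
  simpa only [sub_sub, hU, sub_add_cancel, Finset.sum_add_distrib, add_le_add_iff_left] using hle

theorem snd_eq (hb : IsLeastSquaresFit L U Y' Y'' b) (hLU : L ≠ U) :
    b.2 = (𝔼 i, Y'' i - 𝔼 i, Y' i) / (U - L) := by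
  rw [eq_div_iff (sub_ne_zero.2 hLU.symm), ← hb.fst_add_snd_mul_eq_expect hLU,
    ← hb.swap.fst_add_snd_mul_eq_expect hLU.symm]
  ring

end IsLeastSquaresFit

theorem tendsto_snd_of_isLeastSquaresFit {f : ℝ → ℝ} {β d : ℝ} (hf : HasStrictDerivAt f β d)
    {k : ℕ → ℕ} (hk : ∀ᶠ n in atTop, k n ≠ 0) {L U : ℕ → ℝ} (hL : Tendsto L atTop (𝓝 d))
    (hU : Tendsto U atTop (𝓝 d)) (hLU : ∀ᶠ n in atTop, L n ≠ U n)
    {e' e'' : (n : ℕ) → Fin (k n) → ℝ}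
    (he' : (fun n => 𝔼 i, e' n i) =o[atTop] fun n => U n - L n)
    (he'' : (fun n => 𝔼 i, e'' n i) =o[atTop] fun n => U n - L n) {b : ℕ → ℝ × ℝ}
    (hb : ∀ n, IsLeastSquaresFit (L n) (U n) (fun i => f (L n) + e' n i)
      (fun i => f (U n) + e'' n i) (b n)) :
    Tendsto (fun n => (b n).2) atTop (𝓝 β) := by
  have hquot := (hf.isLittleO.comp_tendsto (hU.prodMk_nhds hL)).tendsto_div_nhds_zero.add
    (he''.sub he').tendsto_div_nhds_zero
  refine (zero_add β ▸ zero_add (0 : ℝ) ▸ hquot.add_const β).congr' ?_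
  filter_upwards [hk, hLU] with n hkn hn
  have : NeZero (k n) := ⟨hkn⟩
  have hne : U n - L n ≠ 0 := sub_ne_zero.2 hn.symm
  rw [(hb n).snd_eq hn, Finset.expect_add_distrib, Finset.expect_add_distrib, Fintype.expect_const,
    Fintype.expect_const]
  simp only [Function.comp_apply, ContinuousLinearMap.toSpanSingleton_apply, smul_eq_mul]
  field_simp
  ring

end LeastSquares

section Bootstrap

theorem pi_abs_expect_sub_integral_ge_le {ι α : Type*} [Fintype ι] [Nonempty ι]
    [MeasurableSpace α] {μ : Measure α} [IsProbabilityMeasure μ] {g : α → ℝ} (hg : MemLp g 2 μ)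
    {η : ℝ} (hη : 0 < η) :
    Measure.pi (fun _ : ι => μ) {r | η ≤ |𝔼 i, g (r i) - ∫ a, g a ∂μ|} ≤
      ENNReal.ofReal (Var[g; μ] / (Fintype.card ι * η ^ 2)) := by
  have hc : (0 : ℝ) < Fintype.card ι := by exact_mod_cast Fintype.card_pos
  set c : ℝ := (Fintype.card ι : ℝ)
  set S : (ι → α) → ℝ := ∑ i, fun r => g (r i)
  have hgi (i : ι) : MemLp (fun r : ι → α => g (r i)) 2 (Measure.pi fun _ => μ) :=
    hg.comp_measurePreserving (measurePreserving_eval _ i)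
  have hS : MemLp S 2 (Measure.pi fun _ => μ) := memLp_finsetSum' _ fun i _ => hgi i
  have hmean : ∫ r, S r ∂(Measure.pi fun _ => μ) = c * ∫ a, g a ∂μ := by
    simp only [S, Finset.sum_apply]
    rw [integral_finsetSum _ fun i _ => (hgi i).integrable one_le_two]
    simp_rw [integral_comp_eval (μ := fun _ : ι => μ) hg.aestronglyMeasurable]
    rw [Finset.sum_const, Finset.card_univ, nsmul_eq_mul]
  have hvar : Var[S; Measure.pi fun _ => μ] = c * Var[g; μ] := by
    rw [variance_sum_pi fun _ => hg, Finset.sum_const, Finset.card_univ, nsmul_eq_mul]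
  have hcheb := meas_ge_le_variance_div_sq hS (mul_pos hc hη)
  rw [hvar, hmean, mul_pow, sq c, mul_assoc, mul_div_mul_left _ _ hc.ne'] at hcheb
  refine (measure_mono fun r (hr : η ≤ _) => ?_).trans hcheb
  have hSr : S r = c * 𝔼 i, g (r i) := by
    rw [Fintype.card_mul_expect]
    exact Finset.sum_apply _ _ _
  rw [mem_ofPred_eq, hSr, ← mul_sub, abs_mul, abs_of_pos hc]
  exact mul_le_mul_of_nonneg_left hr hc.le

theorem integral_uniformOn_univ {α : Type*} [Fintype α] [Nonempty α] [MeasurableSpace α]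
    [MeasurableSingletonClass α] (g : α → ℝ) :
    ∫ a, g a ∂(uniformOn (univ : Set α)) = 𝔼 a, g a := by
  have := isProbabilityMeasure_uniformOn (finite_univ (α := α)) univ_nonempty
  rw [integral_fintype .of_finite, Fintype.expect_eq_sum_div_card, Finset.sum_div]
  refine Finset.sum_congr rfl fun a _ => ?_
  rw [measureReal_def, uniformOn_univ]
  simp [div_eq_inv_mul]

theorem pi_uniformOn_abs_expect_sub_expect_ge_le {k : ℕ} [NeZero k] (Y : Fin k → ℝ) (u : ℝ) {η : ℝ}
    (hη : 0 < η) :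
    Measure.pi (fun _ : Fin k => uniformOn (univ : Set (Fin k)))
        {r | η ≤ |𝔼 i, Y (r i) - 𝔼 i, Y i|} ≤
      ENNReal.ofReal ((∑ i, (Y i - u) ^ 2) / (k * η) ^ 2) := by
  have := isProbabilityMeasure_uniformOn (finite_univ (α := Fin k)) univ_nonempty
  have hcheb := pi_abs_expect_sub_integral_ge_le (ι := Fin k)
    (MemLp.of_discrete (f := Y) (μ := uniformOn univ)) hη
  rw [integral_uniformOn_univ] at hcheb
  refine hcheb.trans (ENNReal.ofReal_le_ofReal ?_)
  have hvar : Var[Y; uniformOn univ] ≤ 𝔼 i, (Y i - u) ^ 2 := by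
    rw [← variance_sub_const (by fun_prop) u, ← integral_uniformOn_univ]
    exact variance_le_expectation_sq (by fun_prop)
  rw [Fintype.card_fin]
  calc Var[Y; uniformOn univ] / (k * η ^ 2)
      ≤ (𝔼 i, (Y i - u) ^ 2) / (k * η ^ 2) := by gcongr
    _ = (∑ i, (Y i - u) ^ 2) / (k * η) ^ 2 := by
      rw [Fintype.expect_eq_sum_div_card, Fintype.card_fin, div_div]
      ring

theorem prod_fst_mem_or_snd_mem_le {α β : Type*} [MeasurableSpace α] [MeasurableSpace β]
    (μ : Measure α) (ν : Measure β) [IsProbabilityMeasure μ] [IsProbabilityMeasure ν]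
    (A : Set α) (B : Set β) : μ.prod ν {z | z.1 ∈ A ∨ z.2 ∈ B} ≤ μ A + ν B := by
  have hunion : {z : α × β | z.1 ∈ A ∨ z.2 ∈ B} = A ×ˢ univ ∪ univ ×ˢ B := by
    ext
    simp
  calc μ.prod ν {z | z.1 ∈ A ∨ z.2 ∈ B} ≤ μ.prod ν (A ×ˢ univ) + μ.prod ν (univ ×ˢ B) :=
        hunion ▸ measure_union_le _ _
    _ = μ A + ν B := by simp [Measure.prod_prod]

theorem IsLeastSquaresFit.bootstrapMeasure_abs_sub_ge_le {k : ℕ} [NeZero k] {L U : ℝ}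
    (hLU : L ≠ U) {Y' Y'' : Fin k → ℝ} {b : ℝ × ℝ} (hb : IsLeastSquaresFit L U Y' Y'' b)
    {bstar : (Fin k → Fin k) × (Fin k → Fin k) → ℝ × ℝ}
    (hbstar : ∀ rs, IsLeastSquaresFit L U (Y' ∘ rs.1) (Y'' ∘ rs.2) (bstar rs))
    (u' u'' : ℝ) {δ : ℝ} (hδ : 0 < δ) :
    bootstrapMeasure k {rs | δ ≤ |(bstar rs).2 - b.2|} ≤
      ENNReal.ofReal ((∑ i, (Y' i - u') ^ 2) / (k * (δ * |U - L| / 2)) ^ 2) +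
      ENNReal.ofReal ((∑ i, (Y'' i - u'') ^ 2) / (k * (δ * |U - L| / 2)) ^ 2) := by
  have := isProbabilityMeasure_uniformOn (finite_univ (α := Fin k)) univ_nonempty
  have hUL : 0 < |U - L| := abs_pos.2 (sub_ne_zero.2 hLU.symm)
  have hη : 0 < δ * |U - L| / 2 := by positivity
  refine (measure_mono fun rs (hrs : δ ≤ _) => ?_).trans
    ((prod_fst_mem_or_snd_mem_le _ _ _ _).trans
      (add_le_add (pi_uniformOn_abs_expect_sub_expect_ge_le Y' u' hη)
        (pi_uniformOn_abs_expect_sub_expect_ge_le Y'' u'' hη)))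
  rw [(hbstar rs).snd_eq hLU, hb.snd_eq hLU, ← sub_div, abs_div, le_div_iff₀ hUL,
    sub_sub_sub_comm] at hrs
  simp only [mem_ofPred_eq]
  by_contra! hsmall
  have htri := abs_sub (𝔼 i, (Y'' ∘ rs.2) i - 𝔼 i, Y'' i) (𝔼 i, (Y' ∘ rs.1) i - 𝔼 i, Y' i)
  simp only [Function.comp_apply] at hrs htri
  linarith [hsmall.1, hsmall.2]

theorem tendsto_bootstrapMeasure_of_isLeastSquaresFit {k : ℕ → ℕ} (hk : ∀ᶠ n in atTop, k n ≠ 0)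
    {L U : ℕ → ℝ} (hLU : ∀ᶠ n in atTop, L n ≠ U n) {Y' Y'' : (n : ℕ) → Fin (k n) → ℝ}
    {u' u'' : ℕ → ℝ}
    (hY' : (fun n => ∑ i, (Y' n i - u' n) ^ 2) =o[atTop] fun n => (k n * (U n - L n)) ^ 2)
    (hY'' : (fun n => ∑ i, (Y'' n i - u'' n) ^ 2) =o[atTop] fun n => (k n * (U n - L n)) ^ 2)
    {b : ℕ → ℝ × ℝ} (hb : ∀ n, IsLeastSquaresFit (L n) (U n) (Y' n) (Y'' n) (b n))
    {bstar : (n : ℕ) → (Fin (k n) → Fin (k n)) × (Fin (k n) → Fin (k n)) → ℝ × ℝ}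
    (hbstar : ∀ n rs,
      IsLeastSquaresFit (L n) (U n) (Y' n ∘ rs.1) (Y'' n ∘ rs.2) (bstar n rs))
    {β : ℝ} (hβ : Tendsto (fun n => (b n).2) atTop (𝓝 β)) {δ : ℝ} (hδ : 0 < δ) :
    Tendsto (fun n => bootstrapMeasure (k n) {rs | δ ≤ |(bstar n rs).2 - β|}) atTop (𝓝 0) := by
  have hlim {v : ℕ → ℝ} (hv : v =o[atTop] fun n => (k n * (U n - L n)) ^ 2) :
      Tendsto (fun n => ENNReal.ofReal (v n / (k n * (δ / 2 * |U n - L n| / 2)) ^ 2)) atTop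
        (𝓝 0) := by
    have hdiv := ENNReal.tendsto_ofReal (hv.tendsto_div_nhds_zero.mul_const ((4 / δ) ^ 2))
    rw [zero_mul, ENNReal.ofReal_zero] at hdiv
    refine hdiv.congr fun n => congrArg _ ?_
    have hsq : (k n * (δ / 2 * |U n - L n| / 2)) ^ 2 = (k n * (U n - L n)) ^ 2 * (δ / 4) ^ 2 := by
      rw [mul_pow (k n : ℝ) (U n - L n), ← sq_abs (U n - L n)]
      ring
    rw [hsq, ← div_div, div_eq_mul_inv _ ((δ / 4) ^ 2), ← inv_pow, inv_div]
  refine tendsto_of_tendsto_of_tendsto_of_le_of_le' tendsto_const_nhds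
    (add_zero (0 : ENNReal) ▸ (hlim hY').add (hlim hY'')) (.of_forall fun _ => zero_le) ?_
  filter_upwards [hk, hLU, Metric.tendsto_nhds.1 hβ _ (half_pos hδ)] with n hkn hn hclose
  have : NeZero (k n) := ⟨hkn⟩
  refine (measure_mono fun rs (hrs : δ ≤ _) => ?_).trans
    ((hb n).bootstrapMeasure_abs_sub_ge_le hn (hbstar n) _ _ (half_pos hδ))
  rw [mem_ofPred_eq]
  rw [Real.dist_eq] at hclose
  linarith [abs_sub_le (bstar n rs).2 (b n).2 β]

end Bootstrap

section SamplingPoints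

theorem upperPoint_sub_lowerPoint (K γ : ℝ) (m : ℕ) (d : ℝ) :
    upperPoint K γ m d - lowerPoint K γ m d = 2 * K * (m : ℝ) ^ (-γ) := by
  rw [upperPoint, lowerPoint]
  ring

variable {K γ : ℝ} {m k : ℕ → ℕ}

theorem eventually_lowerPoint_ne_upperPoint (hK : 0 < K) (γ : ℝ) (hm : Tendsto m atTop atTop)
    (d : ℕ → ℝ) : ∀ᶠ n in atTop, lowerPoint K γ (m n) (d n) ≠ upperPoint K γ (m n) (d n) := by
  filter_upwards [hm.eventually_gt_atTop 0] with n hn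
  rw [ne_comm, ← sub_ne_zero, upperPoint_sub_lowerPoint]
  positivity

theorem tendsto_lowerPoint (hγ : 0 < γ) (hm : Tendsto m atTop atTop) {d : ℕ → ℝ} {d₀ : ℝ}
    (hd : Tendsto d atTop (𝓝 d₀)) :
    Tendsto (fun n => lowerPoint K γ (m n) (d n)) atTop (𝓝 d₀) := by
  simpa [lowerPoint] using hd.sub
    (((tendsto_rpow_neg_atTop hγ).comp (tendsto_natCast_atTop_atTop.comp hm)).const_mul K)

theorem tendsto_upperPoint (hγ : 0 < γ) (hm : Tendsto m atTop atTop) {d : ℕ → ℝ} {d₀ : ℝ}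
    (hd : Tendsto d atTop (𝓝 d₀)) :
    Tendsto (fun n => upperPoint K γ (m n) (d n)) atTop (𝓝 d₀) := by
  simpa [upperPoint] using hd.add
    (((tendsto_rpow_neg_atTop hγ).comp (tendsto_natCast_atTop_atTop.comp hm)).const_mul K)

theorem rpow_isBigO_mul_upperPoint_sub_lowerPoint (hK : 0 < K) (hγ : 0 < γ)
    (hm : Tendsto m atTop atTop) (hmk : (fun n => (m n : ℝ)) =O[atTop] fun n => (k n : ℝ))
    (d : ℕ → ℝ) :
    (fun n => (k n : ℝ) ^ (1 - γ)) =O[atTop]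
      fun n => (k n : ℝ) * (upperPoint K γ (m n) (d n) - lowerPoint K γ (m n) (d n)) := by
  have hpow : (fun n => (m n : ℝ) ^ γ) =O[atTop] fun n => (k n : ℝ) ^ γ :=
    hmk.rpow hγ.le (.of_forall fun n => Nat.cast_nonneg _)
  have hinv := hpow.inv_rev ((hm.eventually_gt_atTop 0).mono fun n hn h =>
    absurd h (by positivity))
  refine .trans ?_ (((isBigO_refl (fun n => (k n : ℝ)) atTop).mul hinv).trans ?_)
  · refine EventuallyEq.isBigO ?_
    filter_upwards [hmk.eq_zero_imp, hm.eventually_gt_atTop 0] with n hkn hmn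
    have hk : (k n : ℝ) ≠ 0 := fun h => hmn.ne' (Nat.cast_eq_zero.1 (hkn h))
    rw [Real.rpow_sub (by positivity), Real.rpow_one, div_eq_mul_inv]
  · simp_rw [upperPoint_sub_lowerPoint, mul_left_comm _ (2 * K),
      Real.rpow_neg (Nat.cast_nonneg _)]
    exact isBigO_self_const_mul (by positivity) _ _

theorem rpow_isBigO_sq_mul_upperPoint_sub_lowerPoint (hK : 0 < K) (hγ : 0 < γ)
    (hm : Tendsto m atTop atTop) (hmk : (fun n => (m n : ℝ)) =O[atTop] fun n => (k n : ℝ))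
    (d : ℕ → ℝ) :
    (fun n => (k n : ℝ) ^ (2 - 2 * γ)) =O[atTop]
      fun n => ((k n : ℝ) * (upperPoint K γ (m n) (d n) - lowerPoint K γ (m n) (d n))) ^ 2 := by
  refine ((rpow_isBigO_mul_upperPoint_sub_lowerPoint hK hγ hm hmk d).pow 2).congr_left fun n => ?_
  rw [← Real.rpow_mul_natCast (Nat.cast_nonneg _)]
  ring_nf

end SamplingPoints

theorem expect_isLittleO_of_sum_isLittleO {k : ℕ → ℕ} {e : (n : ℕ) → Fin (k n) → ℝ} {w : ℕ → ℝ}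
    (he : (fun n => ∑ i, e n i) =o[atTop] fun n => k n * w n) :
    (fun n => 𝔼 i, e n i) =o[atTop] w := by
  simp_rw [Fintype.expect_eq_sum_div_card, Fintype.card_fin, div_eq_inv_mul]
  refine ((isBigO_refl _ _).mul_isLittleO he).trans_isBigO (.of_bound' (.of_forall fun n => ?_))
  rw [← mul_assoc, norm_mul]
  exact mul_le_of_le_one_left (norm_nonneg _) (by
    rcases eq_or_ne (k n : ℝ) 0 with h | h <;> simp [h])

section Sizes

theorem abs_firstSize_sub_le {p : ℝ} (hp : 0 ≤ p) (n : ℕ) : |(firstSize p n : ℝ) - n * p| ≤ 1 := by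
  have hfloor := Nat.floor_le (mul_nonneg n.cast_nonneg hp)
  have hlt := Nat.lt_floor_add_one ((n : ℝ) * p)
  rw [abs_le, firstSize]
  split_ifs <;> push_cast <;> constructor <;> linarith

theorem natCast_isBigO_firstSize {p : ℝ} (hp : 0 < p) :
    (fun n : ℕ => (n : ℝ)) =O[atTop] fun n => (firstSize p n : ℝ) := by
  refine .of_bound (2 / p) ?_
  filter_upwards [tendsto_natCast_atTop_atTop.eventually_ge_atTop (2 / p)] with n hn
  rw [div_le_iff₀ hp] at hn
  rw [Real.norm_natCast, Real.norm_natCast, div_mul_eq_mul_div, le_div_iff₀ hp]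
  linarith [neg_le_of_abs_le (abs_firstSize_sub_le hp.le n)]

theorem firstSize_isBigO_secondSize {p : ℝ} (hp : p ∈ Ioo (0 : ℝ) 1) :
    (fun n => (firstSize p n : ℝ)) =O[atTop] fun n => (secondSize p n : ℝ) := by
  have hp1 : 0 < 1 - p := sub_pos.2 hp.2
  have hfirst (n : ℕ) := le_of_abs_le (abs_firstSize_sub_le hp.1.le n)
  have hnk : (fun n : ℕ => (n : ℝ)) =O[atTop] fun n => (secondSize p n : ℝ) := by
    refine .of_bound (4 / (1 - p)) ?_
    filter_upwards [tendsto_natCast_atTop_atTop.eventually_ge_atTop (4 / (1 - p))] with n hn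
    rw [div_le_iff₀ hp1] at hn
    have hhalf : (n : ℝ) ≤ 2 * secondSize p n + 1 + firstSize p n := by
      rw [secondSize]
      exact_mod_cast (by lia : n ≤ 2 * ((n - firstSize p n) / 2) + 1 + firstSize p n)
    rw [Real.norm_natCast, Real.norm_natCast, div_mul_eq_mul_div, le_div_iff₀ hp1]
    linarith [hfirst n]
  refine .trans (.of_bound 2 ?_) hnk
  filter_upwards [eventually_ge_atTop 1] with n hn
  have hn' : (1 : ℝ) ≤ n := by exact_mod_cast hn
  rw [Real.norm_natCast, Real.norm_natCast]
  nlinarith [hfirst n, hp.2]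

end Sizes

theorem ClassF.hasStrictDerivAt {f : ℝ → ℝ} {d₀ : ℝ} (hf : f ∈ ClassF d₀) :
    HasStrictDerivAt f (deriv f d₀) d₀ :=
  hasStrictDerivAt_of_hasDerivAt_of_continuousAt (hf.1.2.mono fun _ hx => hx.1.hasDerivAt)
    hf.1.2.self_of_nhds.2.2

theorem AssumptionA4.memLp_id {Q : Measure ℝ} (hA4 : AssumptionA4 Q) (r : ℕ) :
    MemLp id r Q := by
  rcases eq_or_ne r 0 with rfl | hr
  · exact_mod_cast memLp_zero_iff_aestronglyMeasurable.2 aestronglyMeasurable_id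
  · rw [← integrable_norm_rpow_iff aestronglyMeasurable_id (by exact_mod_cast hr) (by simp)]
    simpa using hA4 r

theorem AssumptionA4.isNoise {Ω ι : Type*} [MeasurableSpace Ω] {P : Measure Ω} {Q : Measure ℝ}
    (hA4 : AssumptionA4 Q) (hQ : ∫ e, e ∂Q = 0)
    {X : ι → Ω → ℝ} (hlaw : ∀ i, HasLaw (X i) Q P) (hindep : iIndepFun X P) (r : ℕ) :
    IsNoise X r (∫ e, |e| ^ r ∂Q) P where
  indep := hindep
  memLp i := ((hlaw i).map_eq ▸ hA4.memLp_id r).comp_of_map (hlaw i).aemeasurable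
  integral_eq_zero i := (hlaw i).integral_eq.trans hQ
  integral_abs_pow_le i :=
    ((hlaw i).integral_comp (f := fun e => |e| ^ r) (by fun_prop)).le

end TwoStage

open TwoStage in
theorem lemma2_general {Ω : Type*} [MeasurableSpace Ω] (P : Measure Ω) [IsProbabilityMeasure P]
    {K γ d₀ β M : ℝ} {q : ℕ} (hq : 4 ≤ q) (hqγ : 2 ≤ q * (1 - 2 * γ)) (hK : 0 < K) (hγ : 0 < γ)
    (hd₀ : d₀ ∈ Ioo (0 : ℝ) 1) {f : ℝ → ℝ} (hf : StrictMonoOn f (Icc 0 1))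
    (hβ : HasStrictDerivAt f β d₀) {m k : ℕ → ℕ}
    (hm : (fun n : ℕ => (n : ℝ)) =O[atTop] fun n => (m n : ℝ))
    (hmk : (fun n => (m n : ℝ)) =O[atTop] fun n => (k n : ℝ))
    {x : (n : ℕ) → Fin (m n) → ℝ} (hx : ∀ n, Monotone (x n)) (hx01 : ∀ n i, x n i ∈ Icc (0 : ℝ) 1)
    (hdense : IsAsymptoticallyDense x)
    {ε : (n : ℕ) → Fin (m n) → Ω → ℝ} {ε' ε'' : (n : ℕ) → Fin (k n) → Ω → ℝ}
    (hε : ∀ n, IsNoise (ε n) (2 * q) M P) (hε' : ∀ n, IsNoise (ε' n) (2 * q) M P)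
    (hε'' : ∀ n, IsNoise (ε'' n) (2 * q) M P) {fhat : ℕ → Ω → ℝ → ℝ}
    (hfhat : ∀ n ω, IsIsotonicRegression (x n) (fun i => f (x n i) + ε n i ω) (fhat n ω))
    {dhat : ℕ → Ω → ℝ} (hdhat : ∀ n ω, dhat n ω = genInverse (fhat n ω) (f d₀))
    {L U : ℕ → Ω → ℝ} (hL : ∀ n ω, L n ω = lowerPoint K γ (m n) (dhat n ω))
    (hU : ∀ n ω, U n ω = upperPoint K γ (m n) (dhat n ω))
    {Y' Y'' : (n : ℕ) → Ω → Fin (k n) → ℝ} (hY' : ∀ n ω i, Y' n ω i = f (L n ω) + ε' n i ω)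
    (hY'' : ∀ n ω i, Y'' n ω i = f (U n ω) + ε'' n i ω) {βhat : ℕ → Ω → ℝ × ℝ}
    (hβhat : ∀ n ω, IsLeastSquaresFit (L n ω) (U n ω) (Y' n ω) (Y'' n ω) (βhat n ω))
    {βstar : (n : ℕ) → Ω → (Fin (k n) → Fin (k n)) × (Fin (k n) → Fin (k n)) → ℝ × ℝ}
    (hβstar : ∀ n ω r s, IsLeastSquaresFit (L n ω) (U n ω)
      (fun i => Y' n ω (r i)) (fun i => Y'' n ω (s i)) (βstar n ω (r, s))) :
    (∀ᵐ ω ∂P, Tendsto (fun n => (βhat n ω).2) atTop (𝓝 β)) ∧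
    (∀ᵐ ω ∂P, ∀ δ : ℝ, 0 < δ → Tendsto (fun n => bootstrapMeasure (k n)
      {rs | δ ≤ |(βstar n ω rs).2 - β|}) atTop (𝓝 0)) := by
  obtain rfl : dhat = _ := funext₂ hdhat
  obtain rfl : L = _ := funext₂ hL
  obtain rfl : U = _ := funext₂ hU
  obtain rfl : Y' = _ := funext₂ fun n ω => funext (hY' n ω)
  obtain rfl : Y'' = _ := funext₂ fun n ω => funext (hY'' n ω)
  have hm' := tendsto_of_natCast_isBigO hm
  have hnk := hm.trans hmk
  have hk := (tendsto_of_natCast_isBigO hnk).eventually_ne_atTop 0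
  have hLU := eventually_lowerPoint_ne_upperPoint hK γ hm'
  have hwidth := rpow_isBigO_mul_upperPoint_sub_lowerPoint hK hγ hm' hmk
  have hslope : ∀ᵐ ω ∂P, Tendsto (fun n => (βhat n ω).2) atTop (𝓝 β) := by
    filter_upwards [ae_eventually_abs_sum_Icc_le hε hm hq,
      ae_sum_isLittleO_rpow hε' hnk (v := 1 - γ) (by linarith),
      ae_sum_isLittleO_rpow hε'' hnk (v := 1 - γ) (by linarith)] with ω h h' h''
    have hd := tendsto_genInverse hx hx01 hdense hf h (hfhat · ω) hd₀
    exact tendsto_snd_of_isLeastSquaresFit hβ hk (tendsto_lowerPoint hγ hm' hd)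
      (tendsto_upperPoint hγ hm' hd) (hLU _)
      (expect_isLittleO_of_sum_isLittleO (h'.trans_isBigO (hwidth _)))
      (expect_isLittleO_of_sum_isLittleO (h''.trans_isBigO (hwidth _))) (hβhat · ω)
  refine ⟨hslope, ?_⟩
  have hwidth_sq := rpow_isBigO_sq_mul_upperPoint_sub_lowerPoint hK hγ hm' hmk
  filter_upwards [hslope,
    ae_sum_sq_isLittleO_rpow hε' hnk (v := 2 - 2 * γ) (by linarith),
    ae_sum_sq_isLittleO_rpow hε'' hnk (v := 2 - 2 * γ) (by linarith)] with ω hω h' h'' δ hδ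
  refine tendsto_bootstrapMeasure_of_isLeastSquaresFit hk (hLU _)
    (u' := fun n => f (lowerPoint K γ (m n) (genInverse (fhat n ω) (f d₀))))
    (u'' := fun n => f (upperPoint K γ (m n) (genInverse (fhat n ω) (f d₀)))) ?_ ?_
    (hβhat · ω) (fun n rs => hβstar n ω rs.1 rs.2) hω hδ
  · simpa using h'.trans_isBigO (hwidth_sq _)
  · simpa using h''.trans_isBigO (hwidth_sq _)

theorem lemma2
    {Ω : Type*} [MeasurableSpace Ω] (P : Measure Ω) [IsProbabilityMeasure P]
    (p K γ d₀ : ℝ) (hp : p ∈ Set.Ioo (0 : ℝ) 1) (hK : 0 < K) (hγ : γ ∈ Set.Ioo (0 : ℝ) (1 / 2))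
    (hd₀ : d₀ ∈ Set.Ioo (0 : ℝ) 1)
    -- the regression function
    (f : ℝ → ℝ) (hf : f ∈ TwoStage.ClassF d₀) (hA3 : TwoStage.AssumptionA3 f)
    -- the design points
    (x : (m : ℕ) → Fin m → ℝ) (hx : TwoStage.IsDesignArray x) (hA2 : TwoStage.AssumptionA2 x)
    -- the law of the errors
    (Q : Measure ℝ) [IsProbabilityMeasure Q] (hQ : ∫ e, e ∂Q = 0) (hA4 : TwoStage.AssumptionA4 Q)
    -- the first-stage errors and the second-stage errors at the lower and at the upper point
    (ε : (n : ℕ) → Fin (TwoStage.firstSize p n) → Ω → ℝ)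
    (ε' ε'' : (n : ℕ) → Fin (TwoStage.secondSize p n) → Ω → ℝ)
    (hε : ∀ n i, HasLaw (ε n i) Q P)
    (hε' : ∀ n i, HasLaw (ε' n i) Q P)
    (hε'' : ∀ n i, HasLaw (ε'' n i) Q P)
    (hindep : ∀ n, iIndepFun (Sum.elim (ε n) (Sum.elim (ε' n) (ε'' n))) P)
    -- the isotonic regression estimate from the first-stage data
    (fhat : ℕ → Ω → ℝ → ℝ)
    (hfhat : ∀ n ω, TwoStage.IsIsotonicRegression (x (TwoStage.firstSize p n))
      (fun i => f (x (TwoStage.firstSize p n) i) + ε n i ω) (fhat n ω))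
    -- the first-stage estimate of `d₀`
    (dhat : ℕ → Ω → ℝ) (hdhat : ∀ n ω, dhat n ω = TwoStage.genInverse (fhat n ω) (f d₀))
    -- the second-stage sampling points
    (L U : ℕ → Ω → ℝ)
    (hL : ∀ n ω, L n ω = TwoStage.lowerPoint K γ (TwoStage.firstSize p n) (dhat n ω))
    (hU : ∀ n ω, U n ω = TwoStage.upperPoint K γ (TwoStage.firstSize p n) (dhat n ω))
    -- the second-stage responses
    (Y' Y'' : (n : ℕ) → Ω → Fin (TwoStage.secondSize p n) → ℝ)
    (hY' : ∀ n ω i, Y' n ω i = f (L n ω) + ε' n i ω)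
    (hY'' : ∀ n ω i, Y'' n ω i = f (U n ω) + ε'' n i ω)
    -- the least squares estimates (intercept, slope)
    (βhat : ℕ → Ω → ℝ × ℝ)
    (hβhat : ∀ n ω, TwoStage.IsLeastSquaresFit (L n ω) (U n ω) (Y' n ω) (Y'' n ω) (βhat n ω))
    -- the bootstrapped least squares estimates, as functions of the resampled indices `(r, s)`
    (βstar : (n : ℕ) → Ω →
      (Fin (TwoStage.secondSize p n) → Fin (TwoStage.secondSize p n)) ×
        (Fin (TwoStage.secondSize p n) → Fin (TwoStage.secondSize p n)) → ℝ × ℝ)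
    (hβstar : ∀ n ω r s, TwoStage.IsLeastSquaresFit (L n ω) (U n ω)
      (fun i => Y' n ω (r i)) (fun i => Y'' n ω (s i)) (βstar n ω (r, s))) :
    (∀ᵐ ω ∂P, Tendsto (fun n => (βhat n ω).2) atTop (𝓝 (deriv f d₀))) ∧
    (∀ᵐ ω ∂P, ∀ δ : ℝ, 0 < δ →
      Tendsto (fun n => TwoStage.bootstrapMeasure (TwoStage.secondSize p n)
        {rs | δ ≤ |(βstar n ω rs).2 - deriv f d₀|}) atTop (𝓝 0)) := by
  obtain ⟨q, hq⟩ := exists_nat_ge (max 4 (2 / (1 - 2 * γ)))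
  rw [max_le_iff, div_le_iff₀ (by linarith [hγ.2])] at hq
  have hm := TwoStage.natCast_isBigO_firstSize hp.1
  exact lemma2_general P (by exact_mod_cast hq.1) hq.2 hK hγ.1 hd₀ hA3.strictMonoOn
    (TwoStage.ClassF.hasStrictDerivAt hf) hm (TwoStage.firstSize_isBigO_secondSize hp)
    (fun n => (hx _).1.monotone) (fun n => (hx _).2)
    (hA2.isAsymptoticallyDense.comp_tendsto (TwoStage.tendsto_of_natCast_isBigO hm))
    (fun n => hA4.isNoise hQ (hε n) ((hindep n).precomp (g := Sum.inl) Sum.inl_injective) _)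
    (fun n => hA4.isNoise hQ (hε' n)
      ((hindep n).precomp (g := Sum.inr ∘ Sum.inl) (Sum.inr_injective.comp Sum.inl_injective)) _)
    (fun n => hA4.isNoise hQ (hε'' n)
      ((hindep n).precomp (g := Sum.inr ∘ Sum.inr) (Sum.inr_injective.comp Sum.inr_injective)) _)
    hfhat hdhat hL hU hY' hY'' hβhat hβstar
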